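/- Let $W$ be an even Coxeter group of finite rank, that is, $W = \langle s_1,\dots,s_n \mid (s_is_j)^{m_{ij}} = 1 \text{ whenever } m_{ij}\neq\infty\rangle$, where $(m_{ij})$ is a symmetric $n\times n$ matrix with $m_{ii}=1$ for all $i$ and with each $m_{ij}$, $i\ne j$, either a positive even integer or $\infty$. Then every element $x\in W$ of finite order is conjugacy distinguished in $W$: its conjugacy class $x^W=\{w^{-1}xw \mid w\in W\}$ is closed in the profinite topology on $W$, i.e. the topology whose basic open sets are the cosets of the normal subgroups of finite index in $W$. -/

import Mathlib

open scoped Pointwise Topology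

/-- A Coxeter matrix is even if all its off-diagonal entries are even or infinite
(Mathlib encodes `∞` as `0`, which is even). -/
def CoxeterMatrix.IsEven {B : Type*} (M : CoxeterMatrix B) : Prop :=
  ∀ i j : B, i ≠ j → Even (M i j)

/-- The profinite topology on a group: the topology whose basic open sets are the cosets of
normal subgroups of finite index. -/
abbrev profiniteTopology (G : Type*) [Group G] : TopologicalSpace G :=
  TopologicalSpace.generateFrom
    {U : Set G | ∃ (N : Subgroup G) (g : G), N.Normal ∧ N.FiniteIndex ∧ U = g • (N : Set G)}

/-- A subset of a group is separable if it is closed in the profinite topology. -/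
def IsSeparableSubset {G : Type*} [Group G] (S : Set G) : Prop :=
  IsClosed[profiniteTopology G] S

/-- An element is conjugacy distinguished if its conjugacy class is separable. -/
def IsConjugacyDistinguished {G : Type*} [Group G] (x : G) : Prop :=
  IsSeparableSubset (conjugatesOf x)

/-! Let `y` be not conjugate to `x`; some finite quotient must keep `y` off the class of `x`. If `y`
has infinite order, put `n = orderOf x`. Residual finiteness gives a quotient in which `y ^ n`
survives, while the `n`-th power of every conjugate of `x` is trivial.

If `y` has finite order, `x` and `y` are conjugate into finite standard parabolics `W_I` and `W_J`.
Evenness makes killing the other generators a retraction `r_I` onto `W_I`, and these retractions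
commute. After conjugating so that `x ∈ W_I` and `y ∈ W_J`, if both retractions made `x` and `y`
conjugate, then `x ~ r_I y = r_J (r_I y) ~ r_J x ~ y`. So `r_I` or `r_J`, each of finite image,
separates them (`isConj_of_isConj_retraction`).

Both inputs come from the geometric representation. It is faithful with entries in a ring finite
over `ℤ`, so reduction modulo ideals gives residual finiteness; positivity of roots
(`geometricRep_nonneg_of_not_isRightDescent`) and an averaged functional yield the finite
parabolics. -/

section GeometricRepresentation

open Matrix

/-- The matrix of the reflection `v ↦ v - (c i ⬝ᵥ v) • eᵢ` determined by the `i`-th row of `c`. -/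
def reflectionMatrix {B R : Type*} [DecidableEq B] [CommRing R] (c : Matrix B B R) (i : B) :
    Matrix B B R :=
  1 - vecMulVec (Pi.single i 1) (c i)

theorem reflectionMatrix_mulVec {B R : Type*} [Fintype B] [DecidableEq B] [CommRing R]
    (c : Matrix B B R) (i : B) (v : B → R) :
    reflectionMatrix c i *ᵥ v = v - (c i ⬝ᵥ v) • Pi.single i 1 := by
  simp [reflectionMatrix, sub_mulVec, vecMulVec_mulVec]

theorem reflectionMatrix_map {B R S : Type*} [DecidableEq B] [CommRing R] [CommRing S]
    (φ : R →+* S) (c : Matrix B B R) (i : B) :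
    (reflectionMatrix c i).map φ = reflectionMatrix (c.map φ) i := by
  ext j k
  simp [reflectionMatrix, vecMulVec_apply, Pi.single_apply, Matrix.one_apply, apply_ite φ]

/-! ### Cartan matrix, Chebyshev identities and the Coxeter relations. -/

namespace CoxeterMatrix

/-- The Cartan matrix `-2 cos (π / M i j)` of a Coxeter matrix. When `M i j = ∞`, encoded as `0`,
the entry is `-2`. -/
noncomputable def cartan {B : Type*} (M : CoxeterMatrix B) : Matrix B B ℝ :=
  fun i j ↦ -2 * Real.cos (Real.pi / M i j)

variable {B : Type*} (M : CoxeterMatrix B)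

theorem cartan_apply (i j : B) : M.cartan i j = -2 * Real.cos (Real.pi / M i j) := rfl

@[simp]
theorem cartan_self (i : B) : M.cartan i i = 2 := by
  simp [cartan_apply]

theorem cartan_comm (i j : B) : M.cartan i j = M.cartan j i := by
  rw [cartan_apply, cartan_apply, M.symmetric]

theorem isIntegral_cartan (i j : B) : IsIntegral ℤ (M.cartan i j) := by
  have h := (Real.isIntegral_two_mul_cos_rat_mul_pi (1 / (M i j : ℚ))).neg
  convert h using 1
  rw [cartan_apply]
  push_cast
  rw [show Real.pi / (M i j : ℝ) = 1 / (M i j : ℝ) * Real.pi by ring]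
  ring

/-- With `θ = 2π/m`, `S k * sin θ = sin ((k + 1) θ)`, so everything reduces to `mθ = 2π`, by parity
of `m`. These products govern the `m`-th power of a product of two reflections. -/
theorem chebyshevS_mul_eq_zero {m : ℕ} (hm : 3 ≤ m) :
    let S := fun k : ℤ ↦ (Polynomial.Chebyshev.S ℝ k).eval (2 * Real.cos (2 * Real.pi / m))
    S ((m - 2) / 2) * (S ((m - 1) / 2) + S ((m - 3) / 2)) = 0 ∧
      S ((m - 1) / 2) * (S (m / 2) + S ((m - 2) / 2)) = 0 := by
  intro S
  have hm' : (3 : ℝ) ≤ m := by exact_mod_cast hm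
  set θ : ℝ := 2 * Real.pi / m with hθ
  have hmθ : m * θ = 2 * Real.pi := by rw [hθ]; field_simp
  have hsin : Real.sin θ ≠ 0 := by
    refine (Real.sin_pos_of_pos_of_lt_pi (by positivity) ?_).ne'
    rw [hθ, div_lt_iff₀ (by positivity)]
    nlinarith [Real.pi_pos]
  have hS (k : ℤ) : S k * Real.sin θ = Real.sin ((k + 1) * θ) :=
    Polynomial.Chebyshev.S_two_mul_real_cos θ k
  have key (k : ℤ) (h : Real.sin ((k + 1) * θ) = 0) : S k = 0 :=
    (mul_eq_zero.mp ((hS k).trans h)).resolve_right hsin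
  have key' (k l : ℤ) (h : Real.sin ((k + 1) * θ) + Real.sin ((l + 1) * θ) = 0) :
      S k + S l = 0 := by
    rw [← hS, ← hS, ← add_mul] at h
    exact (mul_eq_zero.mp h).resolve_right hsin
  obtain ⟨k, hk | hk⟩ := Nat.even_or_odd' m
  · have hkθ : (k : ℝ) * θ = Real.pi := by
      rw [hk] at hmθ
      push_cast at hmθ
      linarith
    have h0 : S (k - 1) = 0 := key _ (by push_cast; rw [sub_add_cancel, hkθ, Real.sin_pi])
    rw [show ((m : ℤ) - 2) / 2 = k - 1 by omega, show ((m : ℤ) - 1) / 2 = k - 1 by omega, h0]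
    simp
  · have hkθ : (k : ℝ) * θ = 2 * Real.pi - (k + 1) * θ := by
      rw [hk] at hmθ
      push_cast at hmθ
      linarith
    have h0 : S k + S (k - 1) = 0 := key' _ _ (by
      push_cast
      rw [sub_add_cancel, hkθ, Real.sin_two_pi_sub]
      ring)
    rw [show ((m : ℤ) - 2) / 2 = k - 1 by omega, show ((m : ℤ) - 1) / 2 = k by omega,
      show ((m : ℤ) - 3) / 2 = k - 1 by omega, show (m : ℤ) / 2 = k by omega, h0]
    simp

/-- For finite `m = M i j` the value is `sin (pπ/m) / sin (π/m)`; for `m = ∞` it is `p`. -/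
theorem chebyshevS_eval_nonneg (i j : B) (p : ℕ) (hp : M i j ≠ 0 → p ≤ M i j) (hij : i ≠ j) :
    0 ≤ (Polynomial.Chebyshev.S ℝ (p - 1)).eval (-M.cartan i j) := by
  rw [M.cartan_apply, ← neg_mul, neg_neg]
  by_cases h0 : M i j = 0
  · simp [h0, Polynomial.Chebyshev.S_eval_two]
  · have hm : (2 : ℝ) ≤ M i j := by
      have := M.off_diagonal i j hij
      exact_mod_cast (by omega : 2 ≤ M i j)
    have hsin : 0 < Real.sin (Real.pi / M i j) := by
      refine Real.sin_pos_of_pos_of_lt_pi (by positivity) ?_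
      rw [div_lt_iff₀ (by positivity)]
      nlinarith [Real.pi_pos]
    refine nonneg_of_mul_nonneg_left ?_ hsin
    rw [Polynomial.Chebyshev.S_two_mul_real_cos]
    push_cast
    rw [sub_add_cancel]
    have hpm : (p : ℝ) ≤ M i j := by exact_mod_cast hp h0
    refine Real.sin_nonneg_of_nonneg_of_le_pi (by positivity) ?_
    rw [← mul_div_assoc, div_le_iff₀ (by positivity), mul_comm]
    gcongr

variable [Fintype B] [DecidableEq B]

theorem isLiftable_reflectionMatrix : M.IsLiftable (reflectionMatrix M.cartan) := by
  intro i j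
  let f (i : B) : Module.Dual ℝ (B → ℝ) := dotProductBilin ℝ ℝ (M.cartan i)
  have hf (i : B) : f i (Pi.single i 1) = 2 := by simp [f]
  have hr (i : B) (v : B → ℝ) :
      reflectionMatrix M.cartan i *ᵥ v = Module.reflection (hf i) v := by
    rw [reflectionMatrix_mulVec, Module.reflection_apply]
    rfl
  have hpow (n : ℕ) (v : B → ℝ) :
      (reflectionMatrix M.cartan i * reflectionMatrix M.cartan j) ^ n *ᵥ v =
        ((Module.reflection (hf i) * Module.reflection (hf j)) ^ n) v := by
    induction n with
    | zero => simp
    | succ n ih =>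
      rw [pow_succ', ← mulVec_mulVec, ih, ← mulVec_mulVec, hr, hr, pow_succ',
        LinearEquiv.mul_apply, LinearEquiv.mul_apply]
  refine Matrix.ext_of_mulVec_single fun k ↦ ?_
  rw [hpow, one_mulVec]
  generalize (Pi.single k 1 : B → ℝ) = v
  have hfij : f i (Pi.single j 1) = M.cartan i j := by simp [f]
  have hfji : f j (Pi.single i 1) = M.cartan i j := by simp [f, M.cartan_comm j i]
  obtain h0 | h1 | h2 | h3 : M i j = 0 ∨ M i j = 1 ∨ M i j = 2 ∨ 3 ≤ M i j := by omega
  · simp [h0]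
  · obtain rfl : i = j := by
      by_contra hij
      exact M.off_diagonal i j hij h1
    rw [h1, pow_one, LinearEquiv.mul_apply]
    exact Module.involutive_reflection (hf i) v
  · have hc : M.cartan i j = 0 := by simp [cartan_apply, h2]
    rw [hc] at hfij hfji
    rw [h2, pow_two]
    simp only [LinearEquiv.mul_apply, Module.reflection_apply, map_sub, map_smul, hfij, hfji, hf]
    module
  · have ht : 2 * Real.cos (2 * Real.pi / M i j) =
        f i (Pi.single j 1) * f j (Pi.single i 1) - 2 := by
      rw [hfij, hfji, cartan_apply, mul_div_assoc, Real.cos_two_mul]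
      ring
    obtain ⟨e₁, e₂⟩ := chebyshevS_mul_eq_zero h3
    rw [Module.reflection_mul_reflection_pow_apply (hf i) (hf j) (M i j) v _ ht, e₁, e₂]
    simp

end CoxeterMatrix

/-! ### Geometric representation, faithfulness and roots. -/

namespace CoxeterSystem

variable {B W : Type*} [Group W] {M : CoxeterMatrix B} (cs : CoxeterSystem M W)

/-- Stripping right descents alternately in `j` and `i` leaves a `v` with neither descent. This
isolates the dihedral part of `w`. -/
theorem exists_mul_alternatingWord (n : ℕ) : ∀ (w : W) (i j : B), cs.length w = n →
    ¬ cs.IsRightDescent w i → ∃ (v : W) (p : ℕ), w = v * cs.wordProd (alternatingWord i j p) ∧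
      cs.length w = cs.length v + p ∧ ¬ cs.IsRightDescent v i ∧ ¬ cs.IsRightDescent v j := by
  induction n with
  | zero =>
    intro w i j hw hi
    obtain rfl := cs.length_eq_zero_iff.mp hw
    exact ⟨1, 0, by simp [alternatingWord], by simp, hi, cs.not_isRightDescent_one j⟩
  | succ n ih =>
    intro w i j hw hi
    by_cases hj : cs.IsRightDescent w j
    · have hlen := cs.isRightDescent_iff.mp hj
      obtain ⟨v, p, hv, hl, hvj, hvi⟩ := ih (w * cs.simple j) j i (by omega)
        (cs.isRightDescent_iff_not_isRightDescent_mul.mp hj)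
      refine ⟨v, p + 1, ?_, by omega, hvi, hvj⟩
      rw [alternatingWord_succ, wordProd_concat, ← mul_assoc, ← hv,
        simple_mul_simple_cancel_right]
    · exact ⟨w, 0, by simp [alternatingWord], by simp, hi, hj⟩

variable [Fintype B] [DecidableEq B]

/-- The geometric representation of a Coxeter group, in matrix form. -/
noncomputable def geometricRep : W →* Matrix B B ℝ :=
  cs.lift ⟨reflectionMatrix M.cartan, M.isLiftable_reflectionMatrix⟩

theorem geometricRep_simple (i : B) :
    cs.geometricRep (cs.simple i) = reflectionMatrix M.cartan i :=
  cs.lift_apply_simple M.isLiftable_reflectionMatrix i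

theorem geometricRep_simple_mulVec (i : B) (v : B → ℝ) :
    cs.geometricRep (cs.simple i) *ᵥ v = v - (M.cartan i ⬝ᵥ v) • Pi.single i 1 := by
  rw [geometricRep_simple, reflectionMatrix_mulVec]

theorem geometricRep_mul_mulVec (w w' : W) (v : B → ℝ) :
    cs.geometricRep (w * w') *ᵥ v = cs.geometricRep w *ᵥ cs.geometricRep w' *ᵥ v := by
  rw [map_mul, mulVec_mulVec]

@[simp]
theorem geometricRep_simple_self (i : B) :
    cs.geometricRep (cs.simple i) *ᵥ Pi.single i 1 = -Pi.single i 1 := by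
  rw [geometricRep_simple_mulVec, dotProduct_single_one, M.cartan_self]
  module

theorem geometricRep_simple_single (i j : B) :
    cs.geometricRep (cs.simple i) *ᵥ Pi.single j 1 =
      Pi.single j 1 - M.cartan i j • Pi.single i 1 := by
  rw [geometricRep_simple_mulVec, dotProduct_single_one]

theorem geometricRep_simple_mulVec_apply_of_ne {i j : B} (h : j ≠ i) (v : B → ℝ) :
    (cs.geometricRep (cs.simple i) *ᵥ v) j = v j := by
  simp [geometricRep_simple_mulVec, h]

theorem geometricRep_inv_mulVec (w : W) (v : B → ℝ) :
    cs.geometricRep w⁻¹ *ᵥ cs.geometricRep w *ᵥ v = v := by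
  rw [← geometricRep_mul_mulVec]
  simp

theorem geometricRep_mulVec_injective (w : W) :
    Function.Injective (cs.geometricRep w *ᵥ ·) :=
  Function.LeftInverse.injective (g := (cs.geometricRep w⁻¹ *ᵥ ·)) (cs.geometricRep_inv_mulVec w)

theorem geometricRep_alternatingWord (i j : B) (p : ℕ) :
    cs.geometricRep (cs.wordProd (alternatingWord i j p)) *ᵥ Pi.single i 1 =
      (Polynomial.Chebyshev.S ℝ p).eval (-M.cartan i j) • Pi.single (if Even p then i else j) 1 +
      (Polynomial.Chebyshev.S ℝ (p - 1)).eval (-M.cartan i j) •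
        Pi.single (if Even p then j else i) 1 := by
  induction p with
  | zero =>
    rw [alternatingWord, wordProd_nil, map_one, one_mulVec]
    simp
  | succ p ih =>
    have hS := congrArg (Polynomial.eval (-M.cartan i j)) (Polynomial.Chebyshev.S_add_two ℝ (p - 1))
    rw [show (p : ℤ) - 1 + 2 = p + 1 by ring, show (p : ℤ) - 1 + 1 = p by ring] at hS
    simp only [Polynomial.eval_sub, Polynomial.eval_mul, Polynomial.eval_X] at hS
    rw [alternatingWord_succ', wordProd_cons, geometricRep_mul_mulVec, ih, mulVec_add,
      mulVec_smul, mulVec_smul]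
    push_cast
    rw [add_sub_cancel_right, hS]
    by_cases hp : Even p
    · simp only [hp, if_true, Nat.even_add_one, not_true, if_false, geometricRep_simple_self,
        geometricRep_simple_single, M.cartan_comm j i]
      module
    · simp only [hp, if_true, Nat.even_add_one, not_false_eq_true, if_false,
        geometricRep_simple_self, geometricRep_simple_single]
      module

/-- Split off the dihedral part of `w`: it sends `eᵢ` to a nonnegative combination of `eᵢ` and `eⱼ`,
and induction on length applies to the shorter factor `v`. -/
theorem geometricRep_nonneg_of_not_isRightDescent {w : W} {i : B}
    (h : ¬ cs.IsRightDescent w i) : 0 ≤ cs.geometricRep w *ᵥ Pi.single i 1 := by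
  induction hn : cs.length w using Nat.strong_induction_on generalizing w i with
  | _ n ih =>
    by_cases hw : w = 1
    · subst hw
      rw [map_one, one_mulVec]
      exact Pi.single_nonneg.mpr zero_le_one
    obtain ⟨j, hj⟩ := cs.exists_rightDescent_of_ne_one hw
    have hij : i ≠ j := by
      rintro rfl
      exact h hj
    obtain ⟨v, p, hv, hl, hvi, hvj⟩ := cs.exists_mul_alternatingWord _ w i j rfl h
    have hp : p ≠ 0 := by
      rintro rfl
      rw [alternatingWord, wordProd_nil, mul_one] at hv
      exact hvj (hv ▸ hj)
    -- Since `i` is not a descent, `w * sᵢ` has length `ℓ(v) + p + 1`, so the alternating word of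
    -- length `p + 1` is reduced.
    have hpm (hM : M i j ≠ 0) : p + 1 ≤ M i j := by
      by_contra! hlt
      refine cs.not_isReduced_alternatingWord j i (m := p + 1) (by rwa [M.symmetric])
        (by rwa [M.symmetric]) ?_
      have h1 := cs.not_isRightDescent_iff.mp h
      have h2 := cs.length_mul_le v (cs.wordProd (alternatingWord j i (p + 1)))
      have h3 := cs.length_wordProd_le (alternatingWord j i (p + 1))
      rw [length_alternatingWord] at h3
      rw [alternatingWord_succ, wordProd_concat, ← mul_assoc, ← hv, ← wordProd_concat,
        ← alternatingWord_succ] at h2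
      rw [IsReduced, length_alternatingWord]
      omega
    have hpos (k : B) (hk : ¬ cs.IsRightDescent v k) :
        0 ≤ cs.geometricRep v *ᵥ Pi.single k 1 := ih _ (by omega) hk rfl
    have h1 := M.chebyshevS_eval_nonneg i j p (fun h ↦ by have := hpm h; omega) hij
    have h2 := M.chebyshevS_eval_nonneg i j (p + 1) hpm hij
    push_cast at h2
    rw [add_sub_cancel_right] at h2
    rw [hv, geometricRep_mul_mulVec, geometricRep_alternatingWord, mulVec_add, mulVec_smul,
      mulVec_smul]
    refine add_nonneg (smul_nonneg h2 (hpos _ ?_)) (smul_nonneg h1 (hpos _ ?_)) <;>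
      split_ifs <;> assumption

theorem geometricRep_nonpos_of_isRightDescent {w : W} {i : B} (h : cs.IsRightDescent w i) :
    cs.geometricRep w *ᵥ Pi.single i 1 ≤ 0 := by
  have h' := cs.geometricRep_nonneg_of_not_isRightDescent
    (cs.isRightDescent_iff_not_isRightDescent_mul.mp h)
  rwa [geometricRep_mul_mulVec, geometricRep_simple_self, mulVec_neg, neg_nonneg] at h'

theorem geometricRep_injective : Function.Injective cs.geometricRep := by
  rw [injective_iff_map_eq_one]
  intro w hw
  by_contra hne
  obtain ⟨i, hi⟩ := cs.exists_rightDescent_of_ne_one hne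
  have h := cs.geometricRep_nonpos_of_isRightDescent hi i
  rw [hw, one_mulVec] at h
  simp at h
  linarith

/-- The roots of a Coxeter system: the orbit of the standard basis under the geometric
representation. -/
def roots : Set (B → ℝ) := {β | ∃ (w : W) (i : B), β = cs.geometricRep w *ᵥ Pi.single i 1}

variable {cs}

theorem single_mem_roots (i : B) : Pi.single i 1 ∈ cs.roots := ⟨1, i, by rw [map_one, one_mulVec]⟩

theorem geometricRep_mulVec_mem_roots (w : W) {β : B → ℝ} (h : β ∈ cs.roots) :
    cs.geometricRep w *ᵥ β ∈ cs.roots := by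
  obtain ⟨w', i, rfl⟩ := h
  exact ⟨w * w', i, (cs.geometricRep_mul_mulVec _ _ _).symm⟩

theorem neg_mem_roots {β : B → ℝ} (h : β ∈ cs.roots) : -β ∈ cs.roots := by
  obtain ⟨w, i, rfl⟩ := h
  exact ⟨w * cs.simple i, i, by
    rw [geometricRep_mul_mulVec, geometricRep_simple_self, mulVec_neg]⟩

theorem nonneg_or_nonpos_of_mem_roots {β : B → ℝ} (h : β ∈ cs.roots) : 0 ≤ β ∨ β ≤ 0 := by
  obtain ⟨w, i, rfl⟩ := h
  by_cases hi : cs.IsRightDescent w i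
  · exact Or.inr (cs.geometricRep_nonpos_of_isRightDescent hi)
  · exact Or.inl (cs.geometricRep_nonneg_of_not_isRightDescent hi)

theorem ne_zero_of_mem_roots {β : B → ℝ} (h : β ∈ cs.roots) : β ≠ 0 := by
  obtain ⟨w, i, rfl⟩ := h
  intro h0
  have := cs.geometricRep_mulVec_injective w (h0.trans (mulVec_zero _).symm)
  simpa using congrFun this i

theorem geometricRep_quadratic (w : W) (v : B → ℝ) :
    (cs.geometricRep w *ᵥ v) ⬝ᵥ M.cartan *ᵥ (cs.geometricRep w *ᵥ v) = v ⬝ᵥ M.cartan *ᵥ v := by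
  induction w using cs.simple_induction_left generalizing v with
  | one => simp
  | mul_simple_left w i ih =>
    rw [geometricRep_mul_mulVec, ← ih v]
    generalize cs.geometricRep w *ᵥ v = u
    have h1 : u ⬝ᵥ M.cartan *ᵥ Pi.single i 1 = M.cartan i ⬝ᵥ u := by
      rw [mulVec_single_one, dotProduct_comm]
      congr 1
      ext j
      exact M.cartan_comm j i
    have h2 : Pi.single i 1 ⬝ᵥ M.cartan *ᵥ u = M.cartan i ⬝ᵥ u := by
      rw [single_one_dotProduct]
      rfl
    have h3 : (Pi.single i 1 : B → ℝ) ⬝ᵥ M.cartan *ᵥ Pi.single i 1 = 2 := by simp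
    rw [geometricRep_simple_mulVec, mulVec_sub, mulVec_smul, sub_dotProduct, dotProduct_sub,
      dotProduct_sub, smul_dotProduct, dotProduct_smul, smul_dotProduct, dotProduct_smul, h1, h2,
      h3]
    simp only [smul_eq_mul]
    ring

theorem quadratic_of_mem_roots {β : B → ℝ} (h : β ∈ cs.roots) : β ⬝ᵥ M.cartan *ᵥ β = 2 := by
  obtain ⟨w, i, rfl⟩ := h
  rw [geometricRep_quadratic]
  simp

/-- A simple reflection changes only the `i`-th coordinate, so `β` is a multiple of `eᵢ`; the
invariant quadratic form fixes the multiple. -/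
theorem eq_single_of_geometricRep_simple_nonpos {β : B → ℝ} (h : β ∈ cs.roots) (h0 : 0 ≤ β)
    {i : B} (hi : cs.geometricRep (cs.simple i) *ᵥ β ≤ 0) : β = Pi.single i 1 := by
  have hβ : β = β i • Pi.single i 1 := by
    ext j
    by_cases hj : j = i
    · subst hj
      simp
    · have := hi j
      rw [geometricRep_simple_mulVec_apply_of_ne cs hj] at this
      simpa [hj] using le_antisymm this (h0 j)
  have hq := quadratic_of_mem_roots h
  rw [hβ] at hq
  simp only [mulVec_smul, smul_dotProduct, dotProduct_smul, smul_eq_mul] at hq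
  have h3 : (Pi.single i 1 : B → ℝ) ⬝ᵥ M.cartan *ᵥ Pi.single i 1 = 2 := by simp
  rw [h3] at hq
  have h1 : β i = 1 := by
    have := h0 i
    simp only [Pi.zero_apply] at this
    nlinarith
  rw [hβ, h1, one_smul]

variable (cs)

/-- The positive roots sent to negative roots by `w`. -/
def invertedRoots (w : W) : Set (B → ℝ) :=
  {β | β ∈ cs.roots ∧ 0 ≤ β ∧ cs.geometricRep w *ᵥ β ≤ 0}

theorem finite_invertedRoots (w : W) : (cs.invertedRoots w).Finite := by
  induction w using cs.simple_induction_left with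
  | one =>
    refine Set.Finite.subset Set.finite_empty ?_
    rintro β ⟨h, h0, h1⟩
    rw [map_one, one_mulVec] at h1
    exact ne_zero_of_mem_roots h (le_antisymm h1 h0)
  | mul_simple_left w i ih =>
    refine (ih.insert (cs.geometricRep w⁻¹ *ᵥ Pi.single i 1)).subset ?_
    rintro β ⟨h, h0, h1⟩
    have hw := geometricRep_mulVec_mem_roots w h
    rcases nonneg_or_nonpos_of_mem_roots hw with h2 | h2
    · left
      rw [geometricRep_mul_mulVec] at h1
      rw [← eq_single_of_geometricRep_simple_nonpos hw h2 h1, geometricRep_inv_mulVec]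
    · exact Or.inr ⟨h, h0, h2⟩

end CoxeterSystem

/-! ### Finite-order elements and finite parabolic subgroups. -/

namespace CoxeterSystem

variable {B W : Type*} [Group W] {M : CoxeterMatrix B} (cs : CoxeterSystem M W)

/-- The standard parabolic subgroup generated by the simple reflections indexed by `I`. -/
def parabolic (I : Set B) : Subgroup W := Subgroup.closure (cs.simple '' I)

variable [Fintype B] [DecidableEq B]

/-- A functional which is negative on only finitely many positive roots can be moved by the group
to one which is nonnegative on the simple roots. -/
theorem exists_forall_nonneg (φ : Module.Dual ℝ (B → ℝ))
    (hφ : {β | β ∈ cs.roots ∧ 0 ≤ β ∧ φ β < 0}.Finite) :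
    ∃ g : W, ∀ i, 0 ≤ φ (cs.geometricRep g *ᵥ Pi.single i 1) := by
  induction hn : {β | β ∈ cs.roots ∧ 0 ≤ β ∧ φ β < 0}.ncard using Nat.strong_induction_on
    generalizing φ with
  | _ n ih =>
    by_cases hpos : ∀ i, 0 ≤ φ (Pi.single i 1)
    · exact ⟨1, fun i ↦ by rw [map_one, one_mulVec]; exact hpos i⟩
    push Not at hpos
    obtain ⟨i, hi⟩ := hpos
    let ψ : Module.Dual ℝ (B → ℝ) := φ ∘ₗ Matrix.mulVecLin (cs.geometricRep (cs.simple i))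
    have hψ (v : B → ℝ) : ψ v = φ (cs.geometricRep (cs.simple i) *ᵥ v) := rfl
    -- `sᵢ` permutes the positive roots other than `eᵢ`, so passing from `φ` to `ψ` loses the
    -- negative value at `eᵢ` and gains none.
    have hmaps : ∀ β ∈ {β | β ∈ cs.roots ∧ 0 ≤ β ∧ ψ β < 0},
        cs.geometricRep (cs.simple i) *ᵥ β ∈
          {β | β ∈ cs.roots ∧ 0 ≤ β ∧ φ β < 0} \ {Pi.single i 1} := by
      rintro β ⟨h, h0, h1⟩
      have hr := geometricRep_mulVec_mem_roots (cs.simple i) h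
      refine ⟨⟨hr, (nonneg_or_nonpos_of_mem_roots hr).resolve_right fun hneg ↦ ?_, h1⟩,
        fun heq ↦ ?_⟩
      · rw [hψ, eq_single_of_geometricRep_simple_nonpos h h0 hneg, geometricRep_simple_self,
          map_neg] at h1
        linarith
      · rw [Set.mem_singleton_iff] at heq
        have h2 := cs.geometricRep_inv_mulVec (cs.simple i) β
        rw [heq, inv_simple, geometricRep_simple_self] at h2
        rw [← h2] at h0
        have := h0 i
        simp at this
        linarith
    have hinj : Set.InjOn (cs.geometricRep (cs.simple i) *ᵥ ·)
        {β | β ∈ cs.roots ∧ 0 ≤ β ∧ ψ β < 0} :=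
      (cs.geometricRep_mulVec_injective _).injOn
    have hlt : {β | β ∈ cs.roots ∧ 0 ≤ β ∧ ψ β < 0}.ncard < n := by
      refine (Set.ncard_le_ncard_of_injOn _ hmaps hinj hφ.sdiff).trans_lt ?_
      rw [← hn]
      exact Set.ncard_sdiff_singleton_lt_of_mem
        ⟨single_mem_roots i, Pi.single_nonneg.mpr zero_le_one, hi⟩ hφ
    obtain ⟨g, hg⟩ := ih _ hlt ψ
      (Set.Finite.of_finite_image (hφ.sdiff.subset (Set.image_subset_iff.mpr hmaps)) hinj) rfl
    refine ⟨cs.simple i * g, fun j ↦ ?_⟩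
    rw [geometricRep_mul_mulVec]
    exact hg j

theorem map_nonneg_of_forall_single {φ : Module.Dual ℝ (B → ℝ)}
    (hφ : ∀ i, 0 ≤ φ (Pi.single i 1)) {v : B → ℝ} (hv : 0 ≤ v) : 0 ≤ φ v := by
  rw [← Finset.univ_sum_single v, map_sum]
  refine Finset.sum_nonneg fun i _ ↦ ?_
  rw [← mul_one (v i), ← smul_eq_mul, Pi.single_smul, map_smul]
  exact smul_nonneg (hv i) (hφ i)

/-- The stabilizer of a functional that is nonnegative on the simple roots is contained in the
standard parabolic subgroup of the simple roots on which it vanishes. -/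
theorem mem_parabolic_of_stabilizes {φ : Module.Dual ℝ (B → ℝ)}
    (hφ : ∀ i, 0 ≤ φ (Pi.single i 1)) {w : W} (hw : ∀ v, φ (cs.geometricRep w *ᵥ v) = φ v) :
    w ∈ cs.parabolic {i | φ (Pi.single i 1) = 0} := by
  induction hn : cs.length w using Nat.strong_induction_on generalizing w with
  | _ n ih =>
    by_cases h1 : w = 1
    · exact h1 ▸ one_mem _
    obtain ⟨i, hi⟩ := cs.exists_rightDescent_of_ne_one h1
    have hi0 : φ (Pi.single i 1) = 0 := by
      refine le_antisymm ?_ (hφ i)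
      have := map_nonneg_of_forall_single hφ
        (neg_nonneg.mpr (cs.geometricRep_nonpos_of_isRightDescent hi))
      rw [map_neg, hw] at this
      linarith
    have hmem := ih _ (hn ▸ hi) (w := w * cs.simple i) (fun v ↦ by
      rw [geometricRep_mul_mulVec, hw, geometricRep_simple_mulVec, map_sub, map_smul, hi0]
      simp) rfl
    rw [← cs.simple_mul_simple_cancel_right (w := w) i]
    exact mul_mem hmem (Subgroup.subset_closure ⟨i, hi0, rfl⟩)

theorem map_geometricRep_of_mem_parabolic {φ : Module.Dual ℝ (B → ℝ)} {I : Set B}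
    (hφ : ∀ i ∈ I, φ (Pi.single i 1) = 0) {w : W} (hw : w ∈ cs.parabolic I) (v : B → ℝ) :
    φ (cs.geometricRep w *ᵥ v) = φ v := by
  induction hw using Subgroup.closure_induction generalizing v with
  | mem w hw =>
    obtain ⟨i, hi, rfl⟩ := hw
    rw [geometricRep_simple_mulVec, map_sub, map_smul, hφ i hi]
    simp
  | one => simp
  | mul w w' _ _ h h' => rw [geometricRep_mul_mulVec, h, h']
  | inv w _ h =>
    rw [← h]
    congr 1
    simpa using cs.geometricRep_inv_mulVec w⁻¹ v

/-- At a right descent `i ∉ I`, the `i`-th coordinate is invariant under the parabolic, so the image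
of `eᵢ` could not be nonpositive. -/
theorem eq_one_of_mem_parabolic {I : Set B} {w : W} (hw : w ∈ cs.parabolic I)
    (h : ∀ i ∈ I, cs.geometricRep w *ᵥ Pi.single i 1 = Pi.single i 1) : w = 1 := by
  by_contra hne
  obtain ⟨i, hi⟩ := cs.exists_rightDescent_of_ne_one hne
  have hle := cs.geometricRep_nonpos_of_isRightDescent hi i
  have heq : (cs.geometricRep w *ᵥ Pi.single i 1) i = 1 := by
    by_cases hI : i ∈ I
    · rw [h i hI, Pi.single_eq_same]
    · have := cs.map_geometricRep_of_mem_parabolic (φ := LinearMap.proj i) (I := I)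
        (fun j hj ↦ Pi.single_eq_of_ne (fun hij : i = j ↦ hI (hij ▸ hj)) 1) hw
        (Pi.single i 1)
      rwa [LinearMap.proj_apply, LinearMap.proj_apply, Pi.single_eq_same] at this
  rw [heq] at hle
  exact absurd hle (by simp)

theorem finite_parabolic_of_finite {I : Set B} {F : Set (B → ℝ)} (hF : F.Finite)
    (h : ∀ w ∈ cs.parabolic I, ∀ i ∈ I, cs.geometricRep w *ᵥ Pi.single i 1 ∈ F) :
    Finite (cs.parabolic I) := by
  have : Finite F := hF
  refine Finite.of_injective
    (fun (w : cs.parabolic I) (i : I) ↦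
      (⟨cs.geometricRep w *ᵥ Pi.single i.1 1, h w w.2 i i.2⟩ : F)) fun w w' hww ↦ ?_
  have hone : (w : W)⁻¹ * w' = 1 := by
    refine cs.eq_one_of_mem_parabolic (I := I) (mul_mem (inv_mem w.2) w'.2) fun i hi ↦ ?_
    have := congrArg Subtype.val (congrFun hww ⟨i, hi⟩)
    dsimp only at this
    rw [geometricRep_mul_mulVec, ← this, geometricRep_inv_mulVec]
  exact Subtype.ext (inv_mul_eq_one.mp hone)

/-- Every element of finite order is conjugate into a finite standard parabolic subgroup. -/
theorem exists_conj_mem_finite_parabolic {x : W} (hx : IsOfFinOrder x) :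
    ∃ (g : W) (I : Set B), g⁻¹ * x * g ∈ cs.parabolic I ∧ Finite (cs.parabolic I) := by
  let φ₀ : Module.Dual ℝ (B → ℝ) := ∑ i, LinearMap.proj i
  have hφ₀ (v : B → ℝ) : φ₀ v = ∑ i, v i := by simp [φ₀]
  -- Summing over the powers of `x` makes `φ` invariant under `x`; it is positive on each positive
  -- root that no `x ^ k` inverts, hence on all but finitely many.
  let φ : Module.Dual ℝ (B → ℝ) :=
    ∑ k ∈ Finset.range (orderOf x), φ₀ ∘ₗ Matrix.mulVecLin (cs.geometricRep (x ^ k))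
  have hφ (v : B → ℝ) :
      φ v = ∑ k ∈ Finset.range (orderOf x), φ₀ (cs.geometricRep (x ^ k) *ᵥ v) := by
    simp [φ]
  have hφx (v : B → ℝ) : φ (cs.geometricRep x *ᵥ v) = φ v := by
    have h := (Finset.sum_range_succ' (fun k ↦ φ₀ (cs.geometricRep (x ^ k) *ᵥ v))
      (orderOf x)).symm.trans (Finset.sum_range_succ _ (orderOf x))
    rw [pow_zero, pow_orderOf_eq_one] at h
    simp_rw [hφ, ← geometricRep_mul_mulVec, ← pow_succ]
    exact add_right_cancel h
  have hφ₀pos {β : B → ℝ} (h : β ∈ cs.roots) (h0 : 0 ≤ β) : 0 < φ₀ β := by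
    rw [hφ₀]
    obtain ⟨i, hi⟩ := Function.ne_iff.mp (ne_zero_of_mem_roots h)
    exact Finset.sum_pos' (fun i _ ↦ h0 i) ⟨i, Finset.mem_univ i, lt_of_le_of_ne (h0 i) hi.symm⟩
  have hmem (g : W) {β : B → ℝ} (h : β ∈ cs.roots) (h0 : 0 ≤ β)
      (hle : φ (cs.geometricRep g *ᵥ β) ≤ 0) :
      β ∈ ⋃ k ∈ Finset.range (orderOf x), cs.invertedRoots (x ^ k * g) := by
    by_contra hcon
    simp only [Set.mem_iUnion, not_exists] at hcon
    refine hle.not_gt ?_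
    rw [hφ]
    refine Finset.sum_pos (fun k hk ↦ ?_) ⟨0, Finset.mem_range.mpr hx.orderOf_pos⟩
    rw [← geometricRep_mul_mulVec]
    have hr := geometricRep_mulVec_mem_roots (x ^ k * g) h
    exact hφ₀pos hr ((nonneg_or_nonpos_of_mem_roots hr).resolve_right
      fun hn ↦ hcon k hk ⟨h, h0, hn⟩)
  have hfin (g : W) : (⋃ k ∈ Finset.range (orderOf x), cs.invertedRoots (x ^ k * g)).Finite :=
    (Finset.range (orderOf x)).finite_toSet.biUnion fun k _ ↦ cs.finite_invertedRoots _
  obtain ⟨g, hg⟩ := cs.exists_forall_nonneg φ ((hfin 1).subset fun β ⟨h, h0, h1⟩ ↦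
    hmem 1 h h0 (by rw [map_one, one_mulVec]; exact h1.le))
  let ψ : Module.Dual ℝ (B → ℝ) := φ ∘ₗ Matrix.mulVecLin (cs.geometricRep g)
  have hψ (v : B → ℝ) : ψ v = φ (cs.geometricRep g *ᵥ v) := rfl
  refine ⟨g, {i | ψ (Pi.single i 1) = 0}, cs.mem_parabolic_of_stabilizes hg fun v ↦ ?_, ?_⟩
  · change φ _ = φ _
    rw [mulVecLin_apply, mulVecLin_apply, ← geometricRep_mul_mulVec,
      show g * (g⁻¹ * x * g) = x * g by group, geometricRep_mul_mulVec, hφx]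
  -- The parabolic moves its simple roots inside the kernel of `ψ`, which contains only finitely
  -- many roots.
  · refine cs.finite_parabolic_of_finite ((hfin g).union (hfin g).neg) fun w hw i hi ↦ ?_
    have h0 : ψ (cs.geometricRep w *ᵥ Pi.single i 1) = 0 :=
      (cs.map_geometricRep_of_mem_parabolic (fun _ h ↦ h) hw _).trans hi
    have hr : cs.geometricRep w *ᵥ Pi.single i 1 ∈ cs.roots := ⟨w, i, rfl⟩
    rcases nonneg_or_nonpos_of_mem_roots hr with h | h
    · exact Or.inl (hmem g hr h h0.le)
    · refine Or.inr (hmem g (neg_mem_roots hr) (neg_nonneg.mpr h) ?_)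
      rw [← hψ, map_neg, h0, neg_zero]

end CoxeterSystem

/-! ### Residual finiteness. -/

/-- In a ring that is finite and torsion-free over `ℤ`, a nonzero element is nonzero modulo some
positive integer with finite quotient. -/
theorem exists_finite_quotient_of_ne_zero {A : Type*} [CommRing A] [Module.Finite ℤ A]
    [IsDomain A] [CharZero A] {a : A} (ha : a ≠ 0) :
    ∃ J : Ideal A, a ∉ J ∧ Finite (A ⧸ J) := by
  have : Module.Free ℤ A := inferInstance
  let b := Module.Free.chooseBasis ℤ A
  obtain ⟨i, hi⟩ : ∃ i, b.repr a i ≠ 0 := by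
    by_contra! h
    exact ha (b.repr.map_eq_zero_iff.mp (Finsupp.ext h))
  -- Exceeding the absolute value of a nonzero coordinate, `n` cannot divide it.
  let n : ℤ := |b.repr a i| + 1
  have hn : n ≠ 0 := by positivity
  refine ⟨Ideal.span {(n : A)}, fun hmem ↦ ?_, ?_⟩
  · obtain ⟨c, hc⟩ := Ideal.mem_span_singleton'.mp hmem
    have h : b.repr a i = n * b.repr c i := by
      rw [← hc, mul_comm, ← zsmul_eq_mul, map_zsmul]
      simp
    have hdvd := Int.le_of_dvd (abs_pos.mpr hi) ((dvd_abs _ _).mpr ⟨_, h⟩)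
    omega
  · exact Ideal.finiteQuotientOfFreeOfNeBot _ (by
      rw [Ne, Ideal.span_singleton_eq_bot]
      exact_mod_cast hn)

namespace CoxeterSystem

variable {B W : Type*} [Group W] {M : CoxeterMatrix B} [Fintype B] [DecidableEq B]

/-- Coxeter groups of finite rank are residually finite. -/
theorem exists_normal_finiteIndex_notMem (cs : CoxeterSystem M W) {w : W} (hw : w ≠ 1) :
    ∃ N : Subgroup W, N.Normal ∧ N.FiniteIndex ∧ w ∉ N := by
  -- The Cartan entries are finitely many algebraic integers, so `A` is finite over `ℤ` and the
  -- representation descends to it.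
  let A : Subalgebra ℤ ℝ := Algebra.adjoin ℤ (Set.range fun p : B × B ↦ M.cartan p.1 p.2)
  have hA : Module.Finite ℤ A := by
    refine Module.Finite.iff_fg (N := Subalgebra.toSubmodule A).mpr
      (fg_adjoin_of_finite (Set.finite_range _) ?_)
    rintro _ ⟨p, rfl⟩
    exact M.isIntegral_cartan _ _
  let c : Matrix B B A := fun i j ↦ ⟨M.cartan i j, Algebra.subset_adjoin ⟨(i, j), rfl⟩⟩
  let ι : A →+* ℝ := A.subtype
  have hc (i : B) : ι.mapMatrix (reflectionMatrix c i) = reflectionMatrix M.cartan i :=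
    reflectionMatrix_map ι c i
  have hι : Function.Injective (ι.mapMatrix (m := B)) :=
    Matrix.map_injective Subtype.val_injective
  have hlift : M.IsLiftable (reflectionMatrix c) := fun i j ↦ hι (by
    rw [map_pow, map_mul, hc, hc, M.isLiftable_reflectionMatrix, map_one])
  let ρ : W →* Matrix B B A := cs.lift ⟨_, hlift⟩
  have hρ : (ι.mapMatrix (m := B)).toMonoidHom.comp ρ = cs.geometricRep :=
    cs.ext_simple fun i ↦ by
      rw [geometricRep_simple, MonoidHom.comp_apply]
      exact (congrArg ι.mapMatrix (cs.lift_apply_simple hlift i)).trans (hc i)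
  have hρw : ρ w ≠ 1 := fun h ↦ hw (cs.geometricRep_injective (by
    rw [← hρ, MonoidHom.comp_apply, h, map_one, map_one]))
  obtain ⟨i, j, hij⟩ : ∃ i j, (ρ w - 1) i j ≠ 0 := by
    by_contra! h
    exact hρw (sub_eq_zero.mp (Matrix.ext h))
  obtain ⟨J, hJ, hfin⟩ := exists_finite_quotient_of_ne_zero hij
  let q : W →* Matrix B B (A ⧸ J) :=
    ((Ideal.Quotient.mk J).mapMatrix (m := B)).toMonoidHom.comp ρ
  refine ⟨q.toHomUnits.ker, inferInstance, inferInstance, fun hmem ↦ hJ ?_⟩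
  have hq : (Ideal.Quotient.mk J).mapMatrix (ρ w) = 1 :=
    congrArg Units.val (MonoidHom.mem_ker.mp hmem)
  rw [← Ideal.Quotient.eq_zero_iff_mem]
  have h : (Ideal.Quotient.mk J).mapMatrix (ρ w - 1) = 0 := by rw [map_sub, hq, map_one, sub_self]
  exact congrFun (congrFun h i) j

end CoxeterSystem

end GeometricRepresentation

/-! ### Retractions of even Coxeter groups. -/

namespace CoxeterSystem

variable {B W : Type*} [Group W] {M : CoxeterMatrix B} (cs : CoxeterSystem M W)

/-- When exactly one of `i`, `j` is killed, the relation becomes `s ^ M i j = 1` for an involution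
`s`: this is where evenness enters. -/
theorem isLiftable_indicator (hM : M.IsEven) (I : Set B) [DecidablePred (· ∈ I)] :
    M.IsLiftable fun i ↦ if i ∈ I then cs.simple i else 1 := by
  intro i j
  have hpow {k : B} (hij : i ≠ j) : cs.simple k ^ M i j = 1 := by
    obtain ⟨n, hn⟩ := hM i j hij
    rw [hn, ← two_mul, pow_mul, simple_sq, one_pow]
  by_cases hi : i ∈ I <;> by_cases hj : j ∈ I <;> simp only [hi, hj, if_true, if_false]
  · exact cs.simple_mul_simple_pow i j
  · rw [mul_one]
    exact hpow (fun h ↦ hj (h ▸ hi))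
  · rw [one_mul]
    exact hpow (fun h ↦ hi (h ▸ hj))
  · simp

open Classical in
/-- The retraction of an even Coxeter group onto a standard parabolic subgroup, killing the other
simple reflections. -/
noncomputable def retraction (hM : M.IsEven) (I : Set B) : W →* W :=
  cs.lift ⟨_, cs.isLiftable_indicator hM I⟩

variable (hM : M.IsEven)

open Classical in
theorem retraction_simple (I : Set B) (i : B) :
    cs.retraction hM I (cs.simple i) = if i ∈ I then cs.simple i else 1 :=
  cs.lift_apply_simple (cs.isLiftable_indicator hM I) i

theorem retraction_of_mem {I : Set B} {w : W} (hw : w ∈ cs.parabolic I) :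
    cs.retraction hM I w = w := by
  refine MonoidHom.eqOn_closure (f := cs.retraction hM I) (g := MonoidHom.id W) ?_ hw
  rintro _ ⟨i, hi, rfl⟩
  simp [retraction_simple, hi]

theorem retraction_mem (I : Set B) (w : W) : cs.retraction hM I w ∈ cs.parabolic I := by
  induction w using cs.simple_induction with
  | simple i =>
    rw [retraction_simple]
    split_ifs with h
    · exact Subgroup.subset_closure ⟨i, h, rfl⟩
    · exact one_mem _
  | one => simp
  | mul w w' h h' => rw [map_mul]; exact mul_mem h h'

theorem retraction_comm (I J : Set B) (w : W) :
    cs.retraction hM I (cs.retraction hM J w) = cs.retraction hM J (cs.retraction hM I w) := by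
  refine DFunLike.congr_fun (f := (cs.retraction hM I).comp (cs.retraction hM J))
    (g := (cs.retraction hM J).comp (cs.retraction hM I)) (cs.ext_simple fun i ↦ ?_) w
  by_cases hi : i ∈ I <;> by_cases hj : i ∈ J <;> simp [retraction_simple, hi, hj]

/-- Elements of standard parabolic subgroups of an even Coxeter group are conjugate as soon
as their images under the retractions onto these subgroups are. -/
theorem isConj_of_isConj_retraction {I J : Set B} {x y : W} (hx : x ∈ cs.parabolic I)
    (hy : y ∈ cs.parabolic J) (hI : IsConj (cs.retraction hM I x) (cs.retraction hM I y))
    (hJ : IsConj (cs.retraction hM J x) (cs.retraction hM J y)) : IsConj x y := by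
  rw [retraction_of_mem cs hM hx] at hI
  rw [retraction_of_mem cs hM hy] at hJ
  have h := (cs.retraction hM J).map_isConj hI
  rw [retraction_comm, retraction_of_mem cs hM hy] at h
  exact hI.trans (h.symm.trans hJ)

end CoxeterSystem

/-! ### Separation by finite quotients. -/

theorem isConjugacyDistinguished_of_forall_exists {G : Type*} [Group G] {x : G}
    (h : ∀ y, ¬ IsConj x y → ∃ N : Subgroup G, N.Normal ∧ N.FiniteIndex ∧
      ∀ z, IsConj x z → y⁻¹ * z ∉ N) : IsConjugacyDistinguished x := by
  let := profiniteTopology G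
  refine ⟨isOpen_iff_forall_mem_open.mpr fun y hy ↦ ?_⟩
  obtain ⟨N, hN, hfin, hsep⟩ := h y (fun hc ↦ hy hc)
  refine ⟨y • (N : Set G), fun z hz hc ↦ ?_,
    TopologicalSpace.isOpen_generateFrom_of_mem ⟨N, y, hN, hfin, rfl⟩,
    mem_own_leftCoset N.toSubmonoid y⟩
  exact hsep z hc (mem_leftCoset_iff y |>.mp hz)

theorem exists_normal_finiteIndex_of_not_isConj_map {G H : Type*} [Group G] [Group H]
    (f : G →* H) [Finite f.range] {x y : G} (h : ¬ IsConj (f x) (f y)) :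
    ∃ N : Subgroup G, N.Normal ∧ N.FiniteIndex ∧ ∀ z, IsConj x z → y⁻¹ * z ∉ N := by
  refine ⟨f.ker, inferInstance, inferInstance, fun z hz hmem ↦ h ?_⟩
  rw [MonoidHom.mem_ker, map_mul, map_inv, inv_mul_eq_one] at hmem
  rw [hmem]
  exact f.map_isConj hz

theorem inv_mul_notMem_of_pow_notMem {G : Type*} [Group G] {x y : G} {n : ℕ}
    (hx : x ^ n = 1) {N : Subgroup G} (hN : N.Normal) (hy : y ^ n ∉ N) :
    ∀ z, IsConj x z → y⁻¹ * z ∉ N := by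
  intro z hz hmem
  obtain ⟨c, rfl⟩ := isConj_iff.mp hz
  have h1 : (QuotientGroup.mk' N) y = QuotientGroup.mk' N (c * x * c⁻¹) :=
    QuotientGroup.eq.mpr hmem
  refine hy ((QuotientGroup.eq_one_iff _).mp ?_)
  change QuotientGroup.mk' N (y ^ n) = 1
  rw [map_pow, h1, ← map_pow, conj_pow, hx, mul_one, mul_inv_cancel, map_one]

theorem mainTheorem10 {B W : Type*} [Finite B] [Group W] {M : CoxeterMatrix B}
    (cs : CoxeterSystem M W) (hM : M.IsEven) (x : W) (hx : IsOfFinOrder x) :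
    IsConjugacyDistinguished x := by
  classical
  have := Fintype.ofFinite B
  refine isConjugacyDistinguished_of_forall_exists fun y hxy ↦ ?_
  by_cases hy : IsOfFinOrder y
  · obtain ⟨g, I, hg, hI⟩ := cs.exists_conj_mem_finite_parabolic hx
    obtain ⟨k, J, hk, hJ⟩ := cs.exists_conj_mem_finite_parabolic hy
    have hgx : IsConj (g⁻¹ * x * g) x := isConj_iff.mpr ⟨g, by group⟩
    have hky : IsConj (k⁻¹ * y * k) y := isConj_iff.mpr ⟨k, by group⟩
    have hfin (K : Set B) [Finite (cs.parabolic K)] : Finite (cs.retraction hM K).range := by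
      refine Set.Finite.subset (s := (cs.parabolic K : Set W)) (Set.toFinite _) ?_
      rintro _ ⟨w, rfl⟩
      exact cs.retraction_mem hM K w
    have hIfin := hfin I
    have hJfin := hfin J
    -- Transfers conjugacy of images to the conjugates of `x` and `y` lying in the parabolics.
    have hconj (K : Set B) (h : IsConj (cs.retraction hM K x) (cs.retraction hM K y)) :
        IsConj (cs.retraction hM K (g⁻¹ * x * g)) (cs.retraction hM K (k⁻¹ * y * k)) :=
      ((cs.retraction hM K).map_isConj hgx).trans
        (h.trans ((cs.retraction hM K).map_isConj hky.symm))
    by_cases h : IsConj (cs.retraction hM I x) (cs.retraction hM I y)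
    · refine exists_normal_finiteIndex_of_not_isConj_map (cs.retraction hM J) fun h' ↦ hxy ?_
      exact hgx.symm.trans
        ((cs.isConj_of_isConj_retraction hM hg hk (hconj I h) (hconj J h')).trans hky)
    · exact exists_normal_finiteIndex_of_not_isConj_map (cs.retraction hM I) h
  · have hpow : y ^ orderOf x ≠ 1 := fun h ↦
      hy (isOfFinOrder_iff_pow_eq_one.mpr ⟨_, hx.orderOf_pos, h⟩)
    obtain ⟨N, hN, hfin, hmem⟩ := cs.exists_normal_finiteIndex_notMem hpow
    exact ⟨N, hN, hfin, inv_mul_notMem_of_pow_notMem (pow_orderOf_eq_one x) hN hmem⟩
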